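/- Fix $T>0$ and integers $m\ge 0$, $d\ge 2$. A \emph{model} is a pair $(\mathcal L(Y,S),K)$, where $\mathcal L(Y,S)$ is the law of a pair of processes on $[0,T]$: a càdlàg $\mathbb R^m$-valued process $Y$ with independent increments, whose initial value $Y_0$ is independent of the increments, and a continuous $\mathbb R^d$-valued process $S$ with strictly positive components and $S^1\equiv 1$ (almost surely); $K\subset\mathbb R^d$ is a closed convex cone with $\mathbb R^d_+\setminus\{0\}\subset \operatorname{int}K$. A \emph{realization} $\mathbf M=(\mathbb B,Y,S,K)$ of the model consists of a stochastic basis $\mathbb B=(\Omega,\mathcal F,\mathbf F,\mathbf P)$ and processes $(Y,S)$ on it with the given joint law, where $\mathbf F=(\mathcal F_t)_{t\le T}$ is the filtration generated by $Y$ (augmented by the $\mathbf P$-null events and made right-continuous) and $S$ is $\mathbf F$-adapted. Write $\mathbf M^1\sim\mathbf M^2$ if both realizations come from the same model, that is, have the same law $\mathcal L(Y,S)$ and the same cone $K$; the stochastic bases may differ. Let $\mathbf M$ be a realization. A \emph{control} is an $\mathbb R^d$-valued $\mathbf F$-adapted càdlàg process $B$ of bounded variation on $[0,T]$, with the convention $B_{0-}=0$,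 which is $K$-decreasing: $B_s-B_t\in K$ for $s\le t$, including $-B_0=B_{0-}-B_0\in K$. For $x\in K$ put, componentwise, $$\widehat V^{i}_t=x^i+\int_{[0,t]}\frac{1}{S^i_u}\,dB^i_u,\qquad V^{x,B,i}_t=S^i_t\,\widehat V^{i}_t ,$$ where the integral includes the jump $B_0$ at time $0$. The set $\mathcal A(x,\mathbf M)$ of admissible strategies consists of the controls $B$ such that almost surely $\widehat V_t\in\widehat K_t:=\{(k^1/S^1_t,\dots,k^d/S^d_t):k\in K\}$ for all $t\in[0,T]$. Let $U:K\times C([0,T];\mathbb R^d)\to\mathbb R_+$ be concave, increasing (for the componentwise order) and Borel measurable in the first argument, and continuous in the second argument for the uniform norm. The Bellman function is $$u(x,\mathbf M)=\sup_{B\in\mathcal A(x,\mathbf M)}\mathbf E\big[U(V^{x,B}_T,S)\big]\in[0,\infty].$$ \textbf{Theorem.} If $\mathbf M^1\sim\mathbf M^2$ are two equivalent model realizations, then $u(x,\mathbf M^1)=u(x,\mathbf M^2)$ for all $x\in K$. -/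

import Mathlib

open MeasureTheory ProbabilityTheory Filter Topology Set
open scoped NNReal ENNReal

universe u v

noncomputable section

namespace ConeMarket

/-! ### Time, paths, path spaces -/

/-- The time interval `[0, T]`. -/
abbrev Time (T : ℝ≥0) : Type := ↥(Set.Icc (0 : ℝ) (T : ℝ))

instance instCompactIccSpaceTime (T : ℝ≥0) : CompactIccSpace (Time T) :=
  ⟨fun {_ _} => isClosed_Icc.isCompact⟩

/-- The initial time `0` in `[0, T]`. -/
def t₀ (T : ℝ≥0) : Time T := ⟨0, le_rfl, T.2⟩

/-- The terminal time `T` in `[0, T]`. -/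
def t₁ (T : ℝ≥0) : Time T := ⟨T, T.2, le_rfl⟩

/-- The Euclidean space `ℝⁿ`. -/
abbrev Vec (n : ℕ) : Type := EuclideanSpace ℝ (Fin n)

/-- Right-continuous paths with left limits. -/
def IsCadlag {T : ℝ≥0} {n : ℕ} (f : Time T → Vec n) : Prop :=
  ∀ t, ContinuousWithinAt f (Set.Ici t) t ∧ ∃ l, Tendsto f (𝓝[<] t) (𝓝 l)

/-- The Skorokhod space `D([0,T]; ℝⁿ)`. It carries the σ-algebra generated by the coordinate
maps `f ↦ f t`, which is the Borel σ-algebra of the Skorokhod `J₁` topology. -/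
abbrev SkorokhodSpace (T : ℝ≥0) (n : ℕ) : Type := {f : Time T → Vec n // IsCadlag f}

/-- The space `C([0,T]; ℝⁿ)` (topology of uniform convergence). -/
abbrev PathSpace (T : ℝ≥0) (n : ℕ) : Type := C(Time T, Vec n)

/-- The σ-algebra on `C([0,T]; ℝⁿ)` generated by the coordinate maps; it is the Borel σ-algebra of
the topology of uniform convergence. -/
instance instMeasurableSpacePathSpace (T : ℝ≥0) (n : ℕ) : MeasurableSpace (PathSpace T n) :=
  MeasurableSpace.comap (fun (f : PathSpace T n) (t : Time T) => f t) MeasurableSpace.pi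

/-! ### Models -/

/-- The data of a model: a law `𝓛(Y, S)` of an `ℝᵐ`-valued càdlàg process `Y` and an `ℝᵈ`-valued
continuous process `S`, and a closed convex cone `K` in `ℝᵈ`. -/
structure MarketModel (T : ℝ≥0) (m d : ℕ) where
  law : Measure (SkorokhodSpace T m × PathSpace T d)
  K : ProperCone ℝ (Vec d)

/-- The standing assumptions on a model. -/
structure MarketModel.IsRegular {T : ℝ≥0} {m d : ℕ} (M : MarketModel T m d) : Prop where
  isProbabilityMeasure : IsProbabilityMeasure M.law
  /-- `Y` has independent increments -/
  indep_increments :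
    HasIndepIncrements (fun (t : Time T) (p : SkorokhodSpace T m × PathSpace T d) => p.1.1 t) M.law
  /-- `Y₀` is independent of the increments of `Y` -/
  indep_initial :
    IndepFun (fun p : SkorokhodSpace T m × PathSpace T d => p.1.1 (t₀ T))
      (fun (p : SkorokhodSpace T m × PathSpace T d) (t : Time T) => p.1.1 t - p.1.1 (t₀ T)) M.law
  /-- prices are strictly positive -/
  price_pos : ∀ᵐ p ∂M.law, ∀ (t : Time T) (i : Fin d), 0 < p.2 t i
  /-- the first asset is the numéraire -/
  numeraire : ∀ᵐ p ∂M.law, ∀ (t : Time T) (i : Fin d), (i : ℕ) = 0 → p.2 t i = 1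
  /-- `int K ⊇ ℝᵈ₊ \ {0}` -/
  orthant : ∀ x : Vec d, (∀ i, 0 ≤ x i) → x ≠ 0 → x ∈ interior (M.K : Set (Vec d))

/-! ### The information flow -/

section Filtration

variable {Ω : Type*} [mΩ : MeasurableSpace Ω]

/-- The σ-algebra generated by the `P`-null events. -/
abbrev nullEvents (P : Measure Ω) : MeasurableSpace Ω :=
  MeasurableSpace.generateFrom {A | MeasurableSet A ∧ P A = 0}

lemma nullEvents_le (P : Measure Ω) : nullEvents P ≤ mΩ :=
  MeasurableSpace.generateFrom_le fun _ hA => hA.1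

lemma measurable_coord {T : ℝ≥0} {n : ℕ} {Y : Ω → SkorokhodSpace T n} (hY : Measurable Y)
    (t : Time T) : Measurable fun ω => (Y ω).1 t :=
  (measurable_pi_apply t).comp (measurable_subtype_coe.comp hY)

/-- The filtration `𝐅^Y` generated by `Y`, made to satisfy the usual conditions:
`𝓕ᵗ = ⋂_{s > t} (σ(Y_u, u ≤ s) ∨ 𝓝)` for `t < T` and `𝓕_T = σ(Y_u, u ≤ T) ∨ 𝓝`, where `𝓝` is the
family of `P`-null events. -/
def generatedFiltration {T : ℝ≥0} {n : ℕ} (P : Measure Ω) (Y : Ω → SkorokhodSpace T n)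
    (hY : Measurable Y) : Filtration (Time T) mΩ :=
  (Filtration.natural (fun (t : Time T) (ω : Ω) => (Y ω).1 t)
      (fun t => (measurable_coord hY t).stronglyMeasurable) ⊔
    Filtration.const (Time T) (nullEvents P) (nullEvents_le P)).rightCont

end Filtration

/-! ### Model realizations -/

/-- A model realization: a stochastic basis `(Ω, 𝓕, 𝐅^Y, P)`, whose filtration is the one generated
by `Y`, processes `Y` and `S`, the latter adapted to `𝐅^Y`, and a cone `K`. -/
structure Realization (T : ℝ≥0) (m d : ℕ) where
  Ω : Type u
  [mΩ : MeasurableSpace Ω]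
  P : Measure Ω
  Y : Ω → SkorokhodSpace T m
  S : Ω → PathSpace T d
  K : ProperCone ℝ (Vec d)
  measurable_Y : Measurable Y
  measurable_S : Measurable S
  regular : MarketModel.IsRegular ⟨P.map fun ω => (Y ω, S ω), K⟩
  adapted_S : Adapted (generatedFiltration P Y measurable_Y) fun (t : Time T) (ω : Ω) => S ω t

attribute [instance] Realization.mΩ

namespace Realization

variable {T : ℝ≥0} {m d : ℕ}

/-- The model `(𝓛(Y, S), K)` from which a realization originates. -/
def model (M : Realization T m d) : MarketModel T m d :=
  ⟨M.P.map fun ω => (M.Y ω, M.S ω), M.K⟩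

/-- The filtration of the stochastic basis. -/
def 𝓕 (M : Realization T m d) : Filtration (Time T) M.mΩ :=
  generatedFiltration M.P M.Y M.measurable_Y

/-- Two realizations are equivalent if they originate from the same model. -/
def Equivalent (M₁ M₂ : Realization T m d) : Prop :=
  M₁.model = M₂.model

end Realization

/-! ### Controls and portfolio processes -/

/-- `f` is `K`-decreasing: `f s - f t ∈ K` whenever `s ≤ t`. -/
def IsKDecreasing {T : ℝ≥0} {d : ℕ} (K : ProperCone ℝ (Vec d)) (f : Time T → Vec d) : Prop :=
  ∀ s t, s ≤ t → f s - f t ∈ K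

/-- The Lebesgue–Stieltjes integral `(g · b)_t = ∫_{[0,t]} g db` against a càdlàg function `b` of
bounded variation on `[0,T]`, with the convention `b_{0-} = 0`: the jump of `b` at time `0` is
`b 0`. The value is `0` if `b` is not of bounded variation. -/
def stieltjesIntegral {T : ℝ≥0} (g b : Time T → ℝ) (t : Time T) : ℝ :=
  open Classical in
  if hb : BoundedVariationOn b Set.univ then
    g (t₀ T) * b (t₀ T) + ∫ᵛ s in Set.Ioc (t₀ T) t, g s ∂•hb.vectorMeasure
  else 0

/-- The portfolio in physical units along paths `s` of prices and `b` of the control: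
`V̂ⁱ = xⁱ + (1 / sⁱ) · bⁱ`. -/
def physicalPortfolio {T : ℝ≥0} {d : ℕ} (x : Vec d) (s b : Time T → Vec d) (t : Time T) : Vec d :=
  WithLp.toLp 2 fun i => x i + stieltjesIntegral (fun u => 1 / s u i) (fun u => b u i) t

/-- The portfolio in monetary units along paths `s` and `b`: `Vⁱ = sⁱ V̂ⁱ`. -/
def portfolio {T : ℝ≥0} {d : ℕ} (x : Vec d) (s b : Time T → Vec d) (t : Time T) : Vec d :=
  WithLp.toLp 2 fun i => s t i * physicalPortfolio x s b t i

/-- The solvency cone in physical units `K / s`, the image of `K` under `xⁱ ↦ xⁱ / sⁱ`. -/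
def physicalCone {d : ℕ} (K : ProperCone ℝ (Vec d)) (s : Vec d) : Set (Vec d) :=
  (fun x : Vec d => (WithLp.toLp 2 fun i => x i / s i : Vec d)) '' (K : Set (Vec d))

namespace Realization

variable {T : ℝ≥0} {m d : ℕ}

/-- Controls (strategies): adapted càdlàg `K`-decreasing processes of bounded variation. As
`B_{0-} = 0`, the process is `K`-decreasing at its initial jump when `-B₀ ∈ K`. -/
structure IsControl (M : Realization T m d) (B : Time T → M.Ω → Vec d) : Prop where
  adapted : Adapted M.𝓕 B
  cadlag : ∀ ω, IsCadlag fun t => B t ω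
  decreasing : ∀ ω, IsKDecreasing M.K fun t => B t ω
  initial : ∀ ω, -B (t₀ T) ω ∈ M.K
  boundedVariation : ∀ ω, BoundedVariationOn (fun t => B t ω) Set.univ

/-- The set `𝒜(x, M)` of admissible strategies: controls for which the portfolio in physical units
stays in `K / S`. -/
def admissible (M : Realization T m d) (x : Vec d) : Set (Time T → M.Ω → Vec d) :=
  {B | M.IsControl B ∧ ∀ᵐ ω ∂M.P, ∀ t : Time T,
    physicalPortfolio x (M.S ω) (fun u => B u ω) t ∈ physicalCone M.K (M.S ω t)}

/-- The Bellman function `u(x, M) = sup_{B ∈ 𝒜(x, M)} 𝔼[U(V_T^{x,B}, S)] ∈ [0, ∞]`. -/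
def bellman (M : Realization T m d) (U : Vec d → PathSpace T d → ℝ) (x : Vec d) : ℝ≥0∞ :=
  ⨆ B ∈ M.admissible x,
    ∫⁻ ω, ENNReal.ofReal (U (portfolio x (M.S ω) (fun u => B u ω) (t₁ T)) (M.S ω)) ∂M.P

end Realization

/-- Utility functions `U : K × C([0,T]; ℝᵈ) → ℝ₊`; the values of `U` outside `K` in the first
argument play no role. -/
structure IsUtility {T : ℝ≥0} {d : ℕ} (K : ProperCone ℝ (Vec d))
    (U : Vec d → PathSpace T d → ℝ) : Prop where
  nonneg : ∀ x ∈ K, ∀ s, 0 ≤ U x s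
  concave : ∀ s, ConcaveOn ℝ (K : Set (Vec d)) fun x => U x s
  increasing : ∀ s, ∀ x ∈ K, ∀ y ∈ K, (∀ i, x i ≤ y i) → U x s ≤ U y s
  continuous : ∀ x ∈ K, Continuous (U x)
  measurable : ∀ s, Measurable fun x : (K : Set (Vec d)) => U x s

end ConeMarket

end

noncomputable section

namespace ConeMarket

/-! ### A countable grid of times -/

/-! The filtration is generated by `Y` up to null events, so a control is almost surely a functional
`b(Y)` of the driving path. Substituting `Y₂` for `Y₁` in `b` gives a strategy on the second basis
with the same joint law of portfolio and prices, hence the same expected utility. This yields one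
inequality between the Bellman functions (`Realization.Equivalent.bellman_le`), and symmetry of the
equivalence yields the other.

Three points need care. The functional must be found for all times at once, with every path a
control path: Doob–Dynkin factorization is done time by time, and the paths are rebuilt as right
limits along a countable grid (`Realization.IsControl.exists_functional`). The substituted strategy
must be adapted: whether `Y⁻¹ A` lies in the augmented filtration is a condition on the law of `Y`
alone (`measurableSet_rawFiltration_iff`), and this survives right limits
(`measurable_generatedFiltration_of_map_eq`). Finally, solvency and terminal utility must be
measurable functionals of `(Y, S)` modulo the law. Integrals of continuous functions are limits of
Riemann sums (`tendsto_riemannSum`), and right-continuity reduces solvency to grid times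
(`nullMeasurableSet_solvent`). -/

/-- The points `j / (n + 1)`, truncated to `[0, T]`. -/
def grid (T : ℝ≥0) (n j : ℕ) : Time T :=
  ⟨min (T : ℝ) ((j : ℝ) / (n + 1)), le_min T.2 (by positivity), min_le_left _ _⟩

/-- The countable dense set of all grid points. -/
def gridSet (T : ℝ≥0) : Set (Time T) :=
  Set.range fun p : ℕ × ℕ => grid T p.1 p.2

/-- The first grid point of level `n` strictly after `t` (or the terminal time). -/
def nextGrid {T : ℝ≥0} (n : ℕ) (t : Time T) : Time T :=
  grid T n (⌊(t : ℝ) * (n + 1)⌋₊ + 1)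

section Grid

variable {T : ℝ≥0}

lemma countable_gridSet : (gridSet T).Countable := Set.countable_range _

lemma coe_grid (n j : ℕ) : (grid T n j : ℝ) = min (T : ℝ) ((j : ℝ) / (n + 1)) := rfl

lemma grid_mem (n j : ℕ) : grid T n j ∈ gridSet T := ⟨(n, j), rfl⟩

lemma nextGrid_mem (n : ℕ) (t : Time T) : nextGrid n t ∈ gridSet T := grid_mem _ _

lemma grid_mono (n : ℕ) : Monotone (grid T n) := by
  intro i j hij
  change min (T : ℝ) ((i : ℝ) / (n + 1)) ≤ min (T : ℝ) ((j : ℝ) / (n + 1))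
  gcongr

lemma grid_zero (n : ℕ) : grid T n 0 = t₀ T := by
  apply Subtype.ext
  rw [coe_grid]
  simp [t₀]

lemma t₀_mem : t₀ T ∈ gridSet T := grid_zero (T := T) 0 ▸ grid_mem 0 0

lemma le_t₁ (t : Time T) : t ≤ t₁ T := t.2.2

lemma t₀_le (t : Time T) : t₀ T ≤ t := t.2.1

lemma monotone_nextGrid (n : ℕ) : Monotone (nextGrid (T := T) n) := by
  intro s t hst
  apply grid_mono
  have : (s : ℝ) ≤ t := hst
  gcongr

lemma lt_floor_add_one_div (n : ℕ) (x : ℝ) :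
    x < ((⌊x * (n + 1)⌋₊ + 1 : ℕ) : ℝ) / (n + 1) := by
  rw [lt_div_iff₀ (by positivity)]
  push_cast
  exact Nat.lt_floor_add_one _

lemma le_nextGrid (n : ℕ) (t : Time T) : t ≤ nextGrid n t := by
  change (t : ℝ) ≤ (nextGrid n t : ℝ)
  rw [nextGrid, coe_grid]
  exact le_min t.2.2 (lt_floor_add_one_div n t).le

lemma lt_nextGrid (n : ℕ) {t : Time T} (ht : t < t₁ T) : t < nextGrid n t := by
  change (t : ℝ) < (nextGrid n t : ℝ)
  rw [nextGrid, coe_grid]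
  exact lt_min ht (lt_floor_add_one_div n t)

lemma nextGrid_t₁ (n : ℕ) : nextGrid n (t₁ T) = t₁ T :=
  le_antisymm (le_t₁ _) (le_nextGrid _ _)

lemma t₁_mem : t₁ T ∈ gridSet T := nextGrid_t₁ (T := T) 0 ▸ nextGrid_mem 0 _

lemma tendsto_nextGrid (t : Time T) : Tendsto (fun n => nextGrid n t) atTop (𝓝 t) := by
  rw [tendsto_subtype_rng]
  have h : Tendsto (fun n : ℕ => (t : ℝ) + 1 / ((n : ℝ) + 1)) atTop (𝓝 ((t : ℝ) + 0)) :=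
    tendsto_const_nhds.add tendsto_one_div_add_atTop_nhds_zero_nat
  rw [add_zero] at h
  refine tendsto_of_tendsto_of_tendsto_of_le_of_le tendsto_const_nhds h
    (fun n => le_nextGrid n t) fun n => ?_
  change (nextGrid n t : ℝ) ≤ _
  rw [nextGrid, coe_grid]
  refine (min_le_right _ _).trans ?_
  rw [div_le_iff₀ (by positivity), add_mul, one_div, inv_mul_cancel₀ (by positivity)]
  push_cast
  have := Nat.floor_le (show 0 ≤ (t : ℝ) * (n + 1) from mul_nonneg t.2.1 (by positivity))
  linarith

lemma tendsto_nextGrid_Ici (t : Time T) : Tendsto (fun n => nextGrid n t) atTop (𝓝[≥] t) :=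
  tendsto_nhdsWithin_iff.2 ⟨tendsto_nextGrid t, Eventually.of_forall fun n => le_nextGrid n t⟩

lemma tendsto_nextGrid_Ioi {t : Time T} (ht : t < t₁ T) :
    Tendsto (fun n => nextGrid n t) atTop (𝓝[gridSet T ∩ Ioi t] t) :=
  tendsto_nhdsWithin_iff.2 ⟨tendsto_nextGrid t,
    Eventually.of_forall fun n => ⟨nextGrid_mem n t, lt_nextGrid n ht⟩⟩

end Grid

/-! ### Control paths -/

/-- The paths of controls: càdlàg `K`-decreasing functions of bounded variation. -/
structure IsControlPath {T : ℝ≥0} {d : ℕ} (K : ProperCone ℝ (Vec d)) (f : Time T → Vec d) :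
    Prop where
  cadlag : IsCadlag f
  decreasing : IsKDecreasing K f
  initial : -f (t₀ T) ∈ K
  boundedVariation : BoundedVariationOn f Set.univ

/-- The traces of control paths on the grid. -/
structure IsControlTrace {T : ℝ≥0} {d : ℕ} (K : ProperCone ℝ (Vec d)) (f : Time T → Vec d) :
    Prop where
  tendsto : ∀ t ∈ gridSet T, Tendsto (fun n => f (nextGrid n t)) atTop (𝓝 (f t))
  decreasing : ∀ s ∈ gridSet T, ∀ t ∈ gridSet T, s ≤ t → f s - f t ∈ K
  initial : -f (t₀ T) ∈ K
  boundedVariation : BoundedVariationOn f (gridSet T)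

section Path

variable {T : ℝ≥0} {d : ℕ} {K : ProperCone ℝ (Vec d)} {f g : Time T → Vec d}

lemma isControlPath_zero : IsControlPath K (fun _ : Time T => (0 : Vec d)) where
  cadlag t := ⟨continuousWithinAt_const, 0, tendsto_const_nhds⟩
  decreasing s t _ := by simp
  initial := by simp
  boundedVariation := by
    have : eVariationOn (fun _ : Time T => (0 : Vec d)) Set.univ = 0 :=
      eVariationOn.constant_on (by
        rintro _ ⟨_, _, rfl⟩ _ ⟨_, _, rfl⟩
        rfl)
    simp [BoundedVariationOn, this]

lemma IsControlPath.tendsto_nextGrid (hf : IsControlPath K f) (t : Time T) :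
    Tendsto (fun n => f (nextGrid n t)) atTop (𝓝 (f t)) :=
  (hf.cadlag t).1.tendsto.comp (tendsto_nextGrid_Ici t)

lemma IsControlPath.isControlTrace (hf : IsControlPath K f) (hfg : EqOn f g (gridSet T)) :
    IsControlTrace K g where
  tendsto t ht := by
    rw [← hfg ht]
    exact (hf.tendsto_nextGrid t).congr fun n => hfg (nextGrid_mem n t)
  decreasing s hs t ht hst := by
    rw [← hfg hs, ← hfg ht]
    exact hf.decreasing s t hst
  initial := by
    rw [← hfg t₀_mem]
    exact hf.initial
  boundedVariation := by
    rw [BoundedVariationOn, ← eVariationOn.eq_of_eqOn hfg]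
    exact hf.boundedVariation.mono (Set.subset_univ _)

lemma IsControlTrace.exists_tendsto (hf : IsControlTrace K f) (t : Time T) :
    ∃ l, Tendsto f (𝓝[gridSet T ∩ Ioi t] t) (𝓝 l) :=
  hf.boundedVariation.exists_tendsto_right t

lemma IsControlTrace.exists_tendsto_nextGrid (hf : IsControlTrace K f) (t : Time T) :
    ∃ l, Tendsto (fun n => f (nextGrid n t)) atTop (𝓝 l) := by
  obtain ht | ht := (le_t₁ t).eq_or_lt
  · exact ⟨f t, hf.tendsto t (ht ▸ t₁_mem)⟩
  · obtain ⟨l, hl⟩ := hf.exists_tendsto t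
    exact ⟨l, hl.comp (tendsto_nextGrid_Ioi ht)⟩

/-- A condition on countably many times thus suffices to produce a genuine control path: each
defining property is closed under the limit from the right along the grid. -/
lemma IsControlTrace.isControlPath (hf : IsControlTrace K f)
    (hg : ∀ t, Tendsto (fun n => f (nextGrid n t)) atTop (𝓝 (g t))) : IsControlPath K g := by
  have hbv : BoundedVariationOn g Set.univ := by
    refine ne_top_of_le_ne_top hf.boundedVariation (iSup_le ?_)
    rintro ⟨n, u, hu, -⟩
    -- `nextGrid k` is monotone, so it maps a partition to a partition inside the grid; each
    -- approximating sum is bounded by the variation of `f` there.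
    have hlim : Tendsto (fun k => ∑ i ∈ Finset.range n,
        edist (f (nextGrid k (u (i + 1)))) (f (nextGrid k (u i)))) atTop
        (𝓝 (∑ i ∈ Finset.range n, edist (g (u (i + 1))) (g (u i)))) :=
      tendsto_finsetSum _ fun i _ => (hg _).edist (hg _)
    refine le_of_tendsto' hlim fun k => ?_
    exact eVariationOn.sum_le (u := fun i => nextGrid k (u i))
      (fun i j hij => monotone_nextGrid k (hu hij)) fun i => nextGrid_mem _ _
  refine ⟨fun t => ⟨?_, ?_⟩, fun s t hst => ?_, ?_, hbv⟩
  · obtain ht | ht := (le_t₁ t).eq_or_lt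
    · have : Ici t = {t} := by
        ext s
        simp only [mem_Ici, mem_singleton_iff]
        exact ⟨fun h => le_antisymm (ht ▸ le_t₁ s) h, fun h => h.ge⟩
      rw [this]
      exact continuousWithinAt_singleton
    · obtain ⟨l, hl⟩ := hf.exists_tendsto t
      have hgl : g t = l :=
        tendsto_nhds_unique (hg t) (hl.comp (tendsto_nextGrid_Ioi ht))
      rw [← continuousWithinAt_Ioi_iff_Ici, ContinuousWithinAt, hgl]
      rw [(Metric.nhds_basis_closedBall).tendsto_right_iff]
      intro ε hε
      have h1 := hl (Metric.closedBall_mem_nhds l hε)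
      rw [mem_map, mem_nhdsWithin_iff_exists_mem_nhds_inter] at h1
      obtain ⟨V, hV, hVs⟩ := h1
      obtain ⟨W, hWV, hWo, htW⟩ := mem_nhds_iff.1 hV
      filter_upwards [mem_nhdsWithin_of_mem_nhds (hWo.mem_nhds htW), self_mem_nhdsWithin]
        with s hsW hts
      refine Metric.isClosed_closedBall.mem_of_tendsto (hg s) ?_
      -- For `s > t` in the open set `W`, the grid points approaching `s` eventually lie in `W` and
      -- beyond `t`, so `g s` inherits the closed bound.
      filter_upwards [(ConeMarket.tendsto_nextGrid s).eventually (hWo.mem_nhds hsW)] with n hn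
      exact hVs ⟨hWV hn, nextGrid_mem _ _, lt_of_lt_of_le hts (le_nextGrid n s)⟩
  · obtain ⟨l, hl⟩ := hbv.exists_tendsto_left t
    exact ⟨l, by simpa using hl⟩
  · exact K.isClosed.mem_of_tendsto ((hg s).sub (hg t)) (Eventually.of_forall fun n =>
      hf.decreasing _ (nextGrid_mem _ _) _ (nextGrid_mem _ _) (monotone_nextGrid n hst))
  · rw [tendsto_nhds_unique (hg (t₀ T)) (hf.tendsto _ t₀_mem)]
    exact hf.initial

end Path

/-! ### Stieltjes integrals of continuous functions -/

section Stieltjes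

variable {T : ℝ≥0}

instance (μ : SignedMeasure (Time T)) : IsFiniteMeasure μ.variation := by
  rw [← SignedMeasure.totalVariation_eq_variation]
  infer_instance

/-- The Riemann sum of level `n` of `g` against `b` over `[0, t]`, with the jump at `0`. -/
def riemannSum (g b : Time T → ℝ) (t : Time T) (n : ℕ) : ℝ :=
  g (t₀ T) * b (t₀ T) + ∑ j ∈ Finset.range (⌈(T : ℝ)⌉₊ * (n + 1)),
    g (grid T n j) * (b (grid T n (j + 1) ⊓ t) - b (grid T n j ⊓ t))

/-- The step function interpolating `g` at the grid points of level `n`, restricted to `(0, t]`. -/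
def gridStep (g : Time T → ℝ) (t : Time T) (n : ℕ) (u : Time T) : ℝ :=
  ∑ j ∈ Finset.range (⌈(T : ℝ)⌉₊ * (n + 1)),
    (Set.Ioc (grid T n j ⊓ t) (grid T n (j + 1) ⊓ t)).indicator (fun _ => g (grid T n j)) u

/-- The cell is found from `j + 1 = ⌈u (n + 1)⌉`; since `u ≤ T ≤ ⌈T⌉`, the number of cells in the
sums is large enough to cover `(0, T]`. -/
lemma exists_grid_lt_le (n : ℕ) {u : Time T} (hu : t₀ T < u) :
    ∃ j < ⌈(T : ℝ)⌉₊ * (n + 1), grid T n j < u ∧ u ≤ grid T n (j + 1) ∧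
      (u : ℝ) - grid T n j ≤ 1 / ((n : ℝ) + 1) := by
  have hu0 : (0 : ℝ) < u := hu
  have hn : (0 : ℝ) < (n : ℝ) + 1 := by positivity
  have hc : 0 < ⌈(u : ℝ) * (n + 1)⌉₊ := Nat.ceil_pos.2 (mul_pos hu0 hn)
  obtain ⟨j, hj⟩ := Nat.exists_eq_add_of_lt hc
  have hj' : ⌈(u : ℝ) * (n + 1)⌉₊ = j + 1 := by omega
  have h1 : (j : ℝ) < (u : ℝ) * (n + 1) := Nat.lt_ceil.1 (by omega)
  have h2 : (u : ℝ) * (n + 1) ≤ (j : ℝ) + 1 := by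
    have := Nat.le_ceil ((u : ℝ) * (n + 1))
    rw [hj'] at this
    exact_mod_cast this
  have h3 : (j : ℝ) / (n + 1) < u := by rwa [div_lt_iff₀ hn]
  have h4 : (u : ℝ) ≤ ((j + 1 : ℕ) : ℝ) / (n + 1) := by
    rw [le_div_iff₀ hn]
    exact_mod_cast h2
  have h5 : (grid T n j : ℝ) = (j : ℝ) / (n + 1) := by
    rw [coe_grid, min_eq_right]
    exact h3.le.trans u.2.2
  refine ⟨j, ?_, ?_, ?_, ?_⟩
  · have : (u : ℝ) * (n + 1) ≤ (⌈(T : ℝ)⌉₊ : ℝ) * (n + 1) := by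
      gcongr
      exact u.2.2.trans (Nat.le_ceil _)
    exact_mod_cast h1.trans_le this
  · change (grid T n j : ℝ) < u
    rwa [h5]
  · change (u : ℝ) ≤ (grid T n (j + 1) : ℝ)
    rw [coe_grid]
    exact le_min u.2.2 h4
  · rw [h5, sub_le_iff_le_add, ← add_div, le_div_iff₀ hn]
    linarith

lemma gridStep_of_notMem (g : Time T → ℝ) {t u : Time T} (n : ℕ) (hu : u ∉ Set.Ioc (t₀ T) t) :
    gridStep g t n u = 0 := by
  refine Finset.sum_eq_zero fun j _ => Set.indicator_of_notMem (fun h => hu ?_) _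
  exact ⟨(le_inf (t₀_le _) (t₀_le _)).trans_lt h.1, h.2.trans inf_le_right⟩

lemma exists_gridStep_eq (g : Time T → ℝ) {t u : Time T} (n : ℕ) (hu : u ∈ Set.Ioc (t₀ T) t) :
    ∃ v : Time T, gridStep g t n u = g v ∧ dist v u ≤ 1 / ((n : ℝ) + 1) := by
  obtain ⟨j, hj, hju, huj, hd⟩ := exists_grid_lt_le n hu.1
  refine ⟨grid T n j, ?_, ?_⟩
  · rw [gridStep, Finset.sum_eq_single_of_mem j (Finset.mem_range.2 hj)]
    · rw [Set.indicator_of_mem]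
      exact ⟨inf_le_left.trans_lt hju, le_inf huj hu.2⟩
    · intro i _ hij
      refine Set.indicator_of_notMem (fun h => ?_) _
      have h1 : grid T n i < u := by
        by_contra! h'
        exact absurd h.1 (not_lt.2 (le_inf h' hu.2))
      have h2 : u ≤ grid T n (i + 1) := h.2.trans inf_le_left
      rcases lt_or_gt_of_ne hij with h3 | h3
      · exact absurd (h2.trans (grid_mono n (Nat.succ_le_of_lt h3))) (not_le.2 hju)
      · exact absurd (huj.trans (grid_mono n (Nat.succ_le_of_lt h3))) (not_le.2 h1)
  · rw [Subtype.dist_eq, Real.dist_eq, abs_sub_comm, abs_of_nonneg]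
    · exact hd
    · have : (grid T n j : ℝ) < u := hju
      linarith

lemma tendsto_gridStep {g : Time T → ℝ} (hg : Continuous g) (t u : Time T) :
    Tendsto (fun n => gridStep g t n u) atTop (𝓝 ((Set.Ioc (t₀ T) t).indicator g u)) := by
  by_cases hu : u ∈ Set.Ioc (t₀ T) t
  · rw [Set.indicator_of_mem hu]
    choose v hv hd using fun n => exists_gridStep_eq g n hu
    simp_rw [hv]
    refine (hg.tendsto u).comp (tendsto_iff_dist_tendsto_zero.2 ?_)
    exact squeeze_zero (fun _ => dist_nonneg) hd tendsto_one_div_add_atTop_nhds_zero_nat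
  · simp_rw [gridStep_of_notMem g _ hu, Set.indicator_of_notMem hu]
    exact tendsto_const_nhds

lemma measurable_gridStep (g : Time T → ℝ) (t : Time T) (n : ℕ) : Measurable (gridStep g t n) := by
  unfold gridStep
  exact Finset.measurable_sum _ fun j _ => measurable_const.indicator measurableSet_Ioc

lemma exists_norm_le {g : Time T → ℝ} (hg : Continuous g) : ∃ C, 0 ≤ C ∧ ∀ u, ‖g u‖ ≤ C := by
  obtain ⟨C, hC⟩ := isCompact_univ.exists_bound_of_continuousOn hg.continuousOn
  exact ⟨C, (norm_nonneg _).trans (hC (t₀ T) (mem_univ _)), fun u => hC u (mem_univ _)⟩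

/-- Each sum is the integral of `gridStep`, which converges pointwise by continuity of `g` and is
bounded by a constant; the variation of `μ` is finite, so dominated convergence applies. -/
lemma tendsto_sum_vectorMeasure {g : Time T → ℝ} (hg : Continuous g)
    (μ : SignedMeasure (Time T)) (t : Time T) :
    Tendsto (fun n : ℕ => ∑ j ∈ Finset.range (⌈(T : ℝ)⌉₊ * (n + 1)),
      g (grid T n j) * μ (Set.Ioc (grid T n j ⊓ t) (grid T n (j + 1) ⊓ t))) atTop
      (𝓝 (∫ᵛ s in Set.Ioc (t₀ T) t, g s ∂•μ)) := by
  obtain ⟨C, hC0, hC⟩ := exists_norm_le hg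
  rw [← VectorMeasure.integral_indicator measurableSet_Ioc]
  have h : Tendsto (fun n => ∫ᵛ u, gridStep g t n u ∂•μ) atTop
      (𝓝 (∫ᵛ u, (Set.Ioc (t₀ T) t).indicator g u ∂•μ)) := by
    refine VectorMeasure.tendsto_integral_of_dominated_convergence (fun _ => C)
      (fun n => (measurable_gridStep g t n).aestronglyMeasurable) (integrable_const C)
      (fun n => Eventually.of_forall fun u => ?_)
      (Eventually.of_forall fun u => tendsto_gridStep hg t u)
    by_cases hu : u ∈ Set.Ioc (t₀ T) t
    · obtain ⟨v, hv, -⟩ := exists_gridStep_eq g n hu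
      rw [hv]
      exact hC v
    · rw [gridStep_of_notMem g n hu, norm_zero]
      exact hC0
  refine h.congr fun n => ?_
  unfold gridStep
  rw [VectorMeasure.integral_finsetSum]
  · refine Finset.sum_congr rfl fun j _ => ?_
    rw [VectorMeasure.integral_indicator_const _ measurableSet_Ioc]
    simp
  · intro j _
    exact (integrable_const _).indicator measurableSet_Ioc

lemma tendsto_riemannSum {g b : Time T → ℝ} (hg : Continuous g)
    (hb : BoundedVariationOn b Set.univ) (hbc : ∀ t, ContinuousWithinAt b (Set.Ici t) t)
    (t : Time T) :
    Tendsto (riemannSum g b t) atTop (𝓝 (stieltjesIntegral g b t)) := by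
  rw [stieltjesIntegral, dif_pos hb]
  -- The measure of a half-open interval is a difference of right limits, which right-continuity
  -- turns into values of `b`.
  have hr : ∀ s, b.rightLim s = b s := fun s =>
    (hbc s).rightLim_eq
  have h := (tendsto_sum_vectorMeasure hg hb.vectorMeasure t).const_add (g (t₀ T) * b (t₀ T))
  refine h.congr fun n => ?_
  rw [riemannSum]
  congr 1
  refine Finset.sum_congr rfl fun j _ => ?_
  rw [hb.vectorMeasure_Ioc (inf_le_inf_right t (grid_mono n j.le_succ)), hr, hr]

lemma tendsto_stieltjesIntegral {g b : Time T → ℝ} (hg : Continuous g)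
    {t : Time T} {τ : ℕ → Time T} (hτ : Tendsto τ atTop (𝓝 t)) (hτt : ∀ n, t ≤ τ n) :
    Tendsto (fun n => stieltjesIntegral g b (τ n)) atTop (𝓝 (stieltjesIntegral g b t)) := by
  by_cases hb : BoundedVariationOn b Set.univ
  · simp_rw [stieltjesIntegral, dif_pos hb]
    refine tendsto_const_nhds.add ?_
    simp_rw [← VectorMeasure.integral_indicator measurableSet_Ioc]
    obtain ⟨C, hC0, hC⟩ := exists_norm_le hg
    refine VectorMeasure.tendsto_integral_of_dominated_convergence (fun _ => C)
      (fun n => (hg.measurable.indicator measurableSet_Ioc).aestronglyMeasurable)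
      (integrable_const C) (fun n => Eventually.of_forall fun u => ?_)
      (Eventually.of_forall fun u => ?_)
    · exact (norm_indicator_le_norm_self _ _).trans (hC u)
    -- The approach is from the right, so the indicators of `(0, τ n]` are eventually constant at
    -- each point, including `u = t`; an atom at `t` does no harm.
    · refine tendsto_const_nhds.congr' ?_
      by_cases hut : u ≤ t
      · refine Eventually.of_forall fun n => ?_
        simp only [Set.indicator, mem_Ioc, hut, hut.trans (hτt n)]
      · filter_upwards [hτ.eventually (eventually_lt_nhds (not_le.1 hut))] with n hn
        simp only [Set.indicator, mem_Ioc, hut, not_le.2 hn]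
  · simp_rw [stieltjesIntegral, dif_neg hb]
    exact tendsto_const_nhds

end Stieltjes

/-! ### Factorization through the driving process -/

section Factorization

variable {Ω X : Type*} [mΩ : MeasurableSpace Ω] [mX : MeasurableSpace X]

lemma nullEvents_le_eventuallyMeasurableSpace (P : Measure Ω) (m : MeasurableSpace Ω) :
    @nullEvents Ω mΩ P ≤ eventuallyMeasurableSpace m (ae P) := by
  refine MeasurableSpace.generateFrom_le fun A hA => ⟨∅, @MeasurableSet.empty _ m, ?_⟩
  exact ae_eq_empty.2 hA.2

/-- A random variable that is `σ(Y)`-measurable modulo null events is almost surely a measurable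
function of `Y`. -/
lemma exists_measurable_comp_ae_eq {E : Type*} [TopologicalSpace E] [SecondCountableTopology E]
    [MeasurableSpace E] [BorelSpace E] [StandardBorelSpace E] [Nonempty E] {P : Measure Ω}
    {Y : Ω → X} {f : Ω → E}
    (hf : EventuallyMeasurable (mX.comap Y) (ae P) f) :
    ∃ b : X → E, Measurable b ∧ f =ᵐ[P] b ∘ Y := by
  have h1 : ∀ V : TopologicalSpace.countableBasis E, ∃ C : Set X, MeasurableSet C ∧
      f ⁻¹' (V : Set E) =ᵐ[P] Y ⁻¹' C := by
    intro V
    obtain ⟨t, ⟨C, hC, rfl⟩, ht⟩ :=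
      hf (TopologicalSpace.isOpen_of_mem_countableBasis V.2).measurableSet
    exact ⟨C, hC, ht⟩
  choose C hC hfC using h1
  have : Countable (TopologicalSpace.countableBasis E) :=
    (TopologicalSpace.countable_countableBasis E).to_subtype
  -- A countable base costs only countably many null sets. On `N` the function is exactly
  -- `σ(Y)`-measurable, and Doob–Dynkin applied there gives a map on all of `X`.
  let N : Set Ω := {ω | ∀ V : TopologicalSpace.countableBasis E, f ω ∈ (V : Set E) ↔ Y ω ∈ C V}
  have hN : ∀ᵐ ω ∂P, ω ∈ N := by
    refine ae_all_iff.2 fun V => ?_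
    filter_upwards [hfC V] with ω hω
    exact iff_of_eq hω
  have hm : Measurable[mX.comap fun ω : N => Y ω] fun ω : N => f ω := by
    rw [BorelSpace.measurable_eq (α := E),
      (TopologicalSpace.isBasis_countableBasis E).borel_eq_generateFrom]
    refine @measurable_generateFrom _ _ (mX.comap fun ω : N => Y ω) _ _ fun V hV => ?_
    refine ⟨C ⟨V, hV⟩, hC _, ?_⟩
    ext ω
    exact (ω.2 ⟨V, hV⟩).symm
  obtain ⟨b, hb, hfb⟩ := hm.exists_eq_measurable_comp
  refine ⟨b, hb, ?_⟩
  filter_upwards [hN] with ω hω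
  exact congrFun hfb ⟨ω, hω⟩

end Factorization

section Transfer

variable {T : ℝ≥0} {n : ℕ}

/-- The σ-algebra on the Skorokhod space generated by the coordinates up to time `s`. -/
abbrev pastPaths (T : ℝ≥0) (n : ℕ) (s : Time T) : MeasurableSpace (SkorokhodSpace T n) :=
  ⨆ j ≤ s, (inferInstance : MeasurableSpace (Vec n)).comap fun y => y.1 j

lemma pastPaths_le (s : Time T) :
    pastPaths T n s ≤ (inferInstance : MeasurableSpace (SkorokhodSpace T n)) :=
  iSup₂_le fun j _ => ((measurable_pi_apply j).comp measurable_subtype_coe).comap_le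

variable {Ω : Type u} [mΩ : MeasurableSpace Ω] (P : Measure Ω) {Y : Ω → SkorokhodSpace T n}
  (hY : Measurable Y)

/-- The filtration generated by `Y` and the null events, before taking right limits. -/
def rawFiltration : Filtration (Time T) mΩ :=
  Filtration.natural (fun (t : Time T) (ω : Ω) => (Y ω).1 t)
      (fun t => (measurable_coord hY t).stronglyMeasurable) ⊔
    Filtration.const (Time T) (nullEvents P) (nullEvents_le P)

lemma rawFiltration_apply (s : Time T) :
    rawFiltration P hY s = (pastPaths T n s).comap Y ⊔ nullEvents P := by
  have : (pastPaths T n s).comap Y =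
      ⨆ j ≤ s, (inferInstance : MeasurableSpace (Vec n)).comap fun ω => (Y ω).1 j := by
    simp only [pastPaths, MeasurableSpace.comap_iSup, MeasurableSpace.comap_comp]
    rfl
  rw [this]
  borelize (Vec n)
  rfl

/-- The right-hand side mentions the basis only through `P.map Y`, which is what allows transfer to
another basis. It holds because adjoining null events changes a past event only by a null set. -/
lemma measurableSet_rawFiltration_iff (s : Time T) {A : Set (SkorokhodSpace T n)}
    (hA : MeasurableSet A) :
    MeasurableSet[rawFiltration P hY s] (Y ⁻¹' A) ↔
      ∃ C, MeasurableSet[pastPaths T n s] C ∧ ∀ᵐ y ∂P.map Y, y ∈ C ↔ y ∈ A := by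
  rw [rawFiltration_apply]
  constructor
  · intro h
    have hle : (pastPaths T n s).comap Y ⊔ nullEvents P ≤
        eventuallyMeasurableSpace ((pastPaths T n s).comap Y) (ae P) :=
      sup_le le_eventuallyMeasurableSpace (nullEvents_le_eventuallyMeasurableSpace P _)
    obtain ⟨_, ⟨C, hC, rfl⟩, ht⟩ := hle _ h
    refine ⟨C, hC, ?_⟩
    rw [ae_map_iff hY.aemeasurable]
    · filter_upwards [ht] with ω hω
      exact (iff_of_eq hω).symm
    · have hC' := pastPaths_le s _ hC
      have : {y | y ∈ C ↔ y ∈ A} = (C ∩ A) ∪ (Cᶜ ∩ Aᶜ) := by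
        ext y
        simp only [mem_ofPred_eq, mem_union, mem_inter_iff, mem_compl_iff]
        tauto
      rw [this]
      exact (hC'.inter hA).union (hC'.compl.inter hA.compl)
  · rintro ⟨C, hC, hCA⟩
    have hC' := pastPaths_le s _ hC
    have hCA' := ae_of_ae_map hY.aemeasurable hCA
    have hnull : ∀ D : Set (SkorokhodSpace T n), MeasurableSet D →
        (∀ y, (y ∈ C ↔ y ∈ A) → y ∉ D) →
        MeasurableSet[(pastPaths T n s).comap Y ⊔ nullEvents P] (Y ⁻¹' D) := by
      intro D hD h
      refine (le_sup_right : nullEvents P ≤ _) _ (MeasurableSpace.measurableSet_generateFrom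
        ⟨hY hD, measure_eq_zero_iff_ae_notMem.2 ?_⟩)
      filter_upwards [hCA'] with ω hω using h _ hω
    have h1 := hnull (C \ A) (hC'.diff hA) (by simp only [Set.mem_sdiff]; tauto)
    have h2 := hnull (A \ C) (hA.diff hC') (by simp only [Set.mem_sdiff]; tauto)
    have h3 : MeasurableSet[(pastPaths T n s).comap Y ⊔ nullEvents P] (Y ⁻¹' C) :=
      (le_sup_left : (pastPaths T n s).comap Y ≤ _) _ ⟨C, hC, rfl⟩
    have : Y ⁻¹' A = (Y ⁻¹' C \ Y ⁻¹' (C \ A)) ∪ Y ⁻¹' (A \ C) := by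
      ext ω
      simp only [mem_preimage, mem_union, Set.mem_sdiff]
      tauto
    rw [this]
    exact MeasurableSet.union (MeasurableSet.diff h3 h1) h2

lemma measurableSet_generatedFiltration_iff (t : Time T) {A : Set (SkorokhodSpace T n)} :
    MeasurableSet[generatedFiltration P Y hY t] (Y ⁻¹' A) ↔
      (t = t₁ T ∧ MeasurableSet[rawFiltration P hY t] (Y ⁻¹' A)) ∨
      (t < t₁ T ∧ ∀ s > t, MeasurableSet[rawFiltration P hY s] (Y ⁻¹' A)) := by
  change MeasurableSet[(rawFiltration P hY).rightCont t] _ ↔ _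
  obtain ht | ht := (le_t₁ t).eq_or_lt
  · rw [Filtration.rightCont_eq_of_isMax _ (ht ▸ fun s _ => le_t₁ s)]
    simp [ht]
  · rw [Filtration.rightCont_eq_of_not_isMax _ (not_isMax_of_lt ht)]
    simp only [MeasurableSpace.measurableSet_iInf, ht, ht.ne, true_and, false_and, false_or]

lemma generatedFiltration_le (t : Time T) : generatedFiltration P Y hY t ≤
    eventuallyMeasurableSpace
      ((inferInstance : MeasurableSpace (SkorokhodSpace T n)).comap Y) (ae P) := by
  have h : rawFiltration P hY (t₁ T) ≤ eventuallyMeasurableSpace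
      ((inferInstance : MeasurableSpace (SkorokhodSpace T n)).comap Y) (ae P) := by
    rw [rawFiltration_apply]
    exact sup_le ((MeasurableSpace.comap_mono (pastPaths_le _)).trans le_eventuallyMeasurableSpace)
      (nullEvents_le_eventuallyMeasurableSpace P _)
  refine le_trans (((rawFiltration P hY).rightCont).mono (le_t₁ t)) ?_
  rwa [Filtration.rightCont_eq_of_isMax _ (fun s _ => le_t₁ s)]

/-- Used to pass adaptedness from a control to its functional version, which agrees with it only
almost surely. -/
lemma measurableSet_generatedFiltration_of_ae_eq (t : Time T) {A A' : Set Ω}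
    (hA : MeasurableSet A) (hAA' : A =ᵐ[P] A')
    (hA' : MeasurableSet[generatedFiltration P Y hY t] A') :
    MeasurableSet[generatedFiltration P Y hY t] A := by
  have hle : nullEvents P ≤ generatedFiltration P Y hY t :=
    le_trans (by rw [rawFiltration_apply]; exact le_sup_right)
      ((rawFiltration P hY).le_rightCont t)
  have hm := (generatedFiltration P Y hY).le t _ hA'
  have h0 := ae_eq_set.1 hAA'
  have h1 := hle _ (MeasurableSpace.measurableSet_generateFrom ⟨hA.diff hm, h0.1⟩)
  have h2 := hle _ (MeasurableSpace.measurableSet_generateFrom ⟨hm.diff hA, h0.2⟩)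
  have : A = (A' \ (A' \ A)) ∪ (A \ A') := by
    ext ω
    simp only [mem_union, Set.mem_sdiff]
    tauto
  rw [this]
  exact MeasurableSet.union (MeasurableSet.diff hA' h2) h1

variable {P hY} in
/-- Measurability of a functional of `Y` with respect to the filtration generated by `Y` depends
only on the law of `Y`. -/
lemma measurable_generatedFiltration_of_map_eq {Ω' : Type v} [MeasurableSpace Ω']
    {P' : Measure Ω'} {Y' : Ω' → SkorokhodSpace T n} {hY' : Measurable Y'}
    (hlaw : P.map Y = P'.map Y') {E : Type*} [MeasurableSpace E] {b : SkorokhodSpace T n → E}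
    (hb : Measurable b) {t : Time T}
    (h : Measurable[generatedFiltration P Y hY t] fun ω => b (Y ω)) :
    Measurable[generatedFiltration P' Y' hY' t] fun ω => b (Y' ω) := by
  intro V hV
  have hA := hb hV
  have h' : MeasurableSet[generatedFiltration P Y hY t] (Y ⁻¹' (b ⁻¹' V)) := h hV
  change MeasurableSet[generatedFiltration P' Y' hY' t] (Y' ⁻¹' (b ⁻¹' V))
  rw [measurableSet_generatedFiltration_iff] at h' ⊢
  simp only [measurableSet_rawFiltration_iff _ _ _ hA] at h' ⊢
  rwa [← hlaw]

end Transfer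

/-! ### Controls as functionals of the driving process -/

section Canonical

variable {T : ℝ≥0} {m d : ℕ}

/-- Variation is lower semicontinuous under pointwise convergence; countability of `α` makes open
sets of the product measurable for the product σ-algebra. -/
lemma measurable_eVariationOn_univ {α E : Type*} [LinearOrder α] [Countable α]
    [PseudoEMetricSpace E] [SecondCountableTopology E] [MeasurableSpace E]
    [OpensMeasurableSpace E] :
    Measurable fun f : α → E => eVariationOn f Set.univ := by
  have : LowerSemicontinuous fun f : α → E => eVariationOn f Set.univ := fun f v hv =>
    eVariationOn.lowerSemicontinuous_aux (F := fun g : α → E => g) (p := 𝓝 f)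
      (fun x _ => (continuous_apply x).tendsto f) hv
  exact this.measurable

lemma measurableSet_isControlTrace {X : Type*} [MeasurableSpace X] (K : ProperCone ℝ (Vec d))
    {f : Time T → X → Vec d} (hf : ∀ t, Measurable (f t)) :
    MeasurableSet {y | IsControlTrace K fun t => f t y} := by
  have hK : MeasurableSet (K : Set (Vec d)) := K.isClosed.measurableSet
  have hD := countable_gridSet (T := T)
  have : Countable (gridSet T) := hD.to_subtype
  have h1 : MeasurableSet {y | ∀ t ∈ gridSet T,
      Tendsto (fun n => f (nextGrid n t) y) atTop (𝓝 (f t y))} := by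
    simp only [Set.ofPred_forall]
    exact MeasurableSet.biInter hD fun t _ => measurableSet_tendsto_fun (fun n => hf _) (hf t)
  have h2 : MeasurableSet {y | ∀ s ∈ gridSet T, ∀ t ∈ gridSet T, s ≤ t → f s y - f t y ∈ K} := by
    simp only [Set.ofPred_forall]
    exact MeasurableSet.biInter hD fun s _ => MeasurableSet.biInter hD fun t _ =>
      MeasurableSet.iInter fun _ => ((hf s).sub (hf t)) hK
  have h3 : MeasurableSet {y | -f (t₀ T) y ∈ K} := (hf _).neg hK
  have h4 : MeasurableSet {y | BoundedVariationOn (fun t => f t y) (gridSet T)} := by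
    have hcomp : ∀ y, eVariationOn (fun t => f t y) (gridSet T) =
        eVariationOn (fun s : gridSet T => f s y) Set.univ := fun y => by
      rw [show (fun s : gridSet T => f s y) = (fun t => f t y) ∘ Subtype.val from rfl,
        eVariationOn.comp_eq_of_monotoneOn _ Subtype.val (fun _ _ _ _ h => h), Set.image_univ,
        Subtype.range_coe]
    have hm : Measurable fun y => eVariationOn (fun t => f t y) (gridSet T) := by
      simp_rw [hcomp]
      exact measurable_eVariationOn_univ.comp
        (measurable_pi_lambda (fun y (s : gridSet T) => f s y) fun s => hf s)
    exact (hm (measurableSet_singleton ⊤)).compl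
  convert! h1.inter (h2.inter (h3.inter h4)) using 1
  ext y
  exact ⟨fun h => ⟨h.tendsto, h.decreasing, h.initial, h.boundedVariation⟩,
    fun h => ⟨h.1, h.2.1, h.2.2.1, h.2.2.2⟩⟩

lemma Realization.IsControl.isControlPath {M : Realization T m d} {B : Time T → M.Ω → Vec d}
    (hB : M.IsControl B) (ω : M.Ω) : IsControlPath M.K fun t => B t ω :=
  ⟨hB.cadlag ω, hB.decreasing ω, hB.initial ω, hB.boundedVariation ω⟩

/-- Every control is almost surely a functional of the driving process, all of whose paths are
control paths. -/
lemma Realization.IsControl.exists_functional {M : Realization T m d} {B : Time T → M.Ω → Vec d}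
    (hB : M.IsControl B) :
    ∃ b : Time T → SkorokhodSpace T m → Vec d, (∀ t, Measurable (b t)) ∧
      (∀ y, IsControlPath M.K fun t => b t y) ∧ ∀ᵐ ω ∂M.P, ∀ t, B t ω = b t (M.Y ω) := by
  classical
  choose f hf hBf using fun t => exists_measurable_comp_ae_eq (P := M.P) (Y := M.Y) (f := B t)
    ((hB.adapted t).mono (generatedFiltration_le M.P M.measurable_Y t) le_rfl)
  -- The versions `f t` were chosen separately for each `t` and need not fit together. Only their
  -- grid values are kept, replaced by zero off `G`, and every `b t` is their limit from the right.
  let G : Set (SkorokhodSpace T m) := {y | IsControlTrace M.K fun t => f t y}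
  have hG : MeasurableSet G := measurableSet_isControlTrace M.K hf
  have hlim : ∀ y, ∃ g : Time T → Vec d, ∀ t,
      Tendsto (fun n => G.indicator (f (nextGrid n t)) y) atTop (𝓝 (g t)) := by
    intro y
    by_cases hy : y ∈ G
    · simp only [Set.indicator_of_mem hy]
      exact ⟨_, fun t => (IsControlTrace.exists_tendsto_nextGrid hy t).choose_spec⟩
    · simp only [Set.indicator_of_notMem hy]
      exact ⟨fun _ => 0, fun _ => tendsto_const_nhds⟩
  choose b hb using hlim
  refine ⟨fun t y => b y t, fun t => ?_, fun y => ?_, ?_⟩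
  · exact measurable_of_tendsto_metrizable (fun n => (hf (nextGrid n t)).indicator hG)
      (tendsto_pi_nhds.2 fun y => hb y t)
  · by_cases hy : y ∈ G
    · refine IsControlTrace.isControlPath hy fun t => ?_
      simpa only [Set.indicator_of_mem hy] using hb y t
    · have : (fun t => b y t) = fun _ => 0 := by
        funext t
        refine tendsto_nhds_unique (hb y t) ?_
        simp only [Set.indicator_of_notMem hy]
        exact tendsto_const_nhds
      rw [this]
      exact isControlPath_zero
  · have hD : ∀ᵐ ω ∂M.P, ∀ t ∈ gridSet T, B t ω = f t (M.Y ω) :=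
      (ae_ball_iff countable_gridSet).2 fun t _ => hBf t
    filter_upwards [hD] with ω hω t
    have hG' : M.Y ω ∈ G := (hB.isControlPath ω).isControlTrace hω
    refine tendsto_nhds_unique ((hB.isControlPath ω).tendsto_nextGrid t) ?_
    refine (hb (M.Y ω) t).congr fun n => ?_
    rw [Set.indicator_of_mem hG', hω _ (nextGrid_mem n t)]

lemma Realization.measurable_YS (M : Realization T m d) :
    Measurable fun ω => (M.Y ω, M.S ω) :=
  M.measurable_Y.prodMk M.measurable_S

lemma Realization.Equivalent.map_eq {M₁ : Realization.{u} T m d} {M₂ : Realization.{v} T m d}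
    (hM : M₁.Equivalent M₂) :
    M₁.P.map (fun ω => (M₁.Y ω, M₁.S ω)) = M₂.P.map fun ω => (M₂.Y ω, M₂.S ω) :=
  congrArg MarketModel.law hM

lemma Realization.Equivalent.cone_eq {M₁ : Realization.{u} T m d} {M₂ : Realization.{v} T m d}
    (hM : M₁.Equivalent M₂) : M₁.K = M₂.K :=
  congrArg MarketModel.K hM

lemma Realization.Equivalent.map_Y_eq {M₁ : Realization.{u} T m d} {M₂ : Realization.{v} T m d}
    (hM : M₁.Equivalent M₂) : M₁.P.map M₁.Y = M₂.P.map M₂.Y := by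
  have h := congrArg (Measure.map Prod.fst) hM.map_eq
  rwa [Measure.map_map measurable_fst M₁.measurable_YS,
    Measure.map_map measurable_fst M₂.measurable_YS] at h

/-- A functional of the driving process which is a control for one realization is a control for
every equivalent realization. -/
lemma Realization.Equivalent.isControl {M₁ : Realization.{u} T m d} {M₂ : Realization.{v} T m d}
    (hM : M₁.Equivalent M₂) {B : Time T → M₁.Ω → Vec d} (hB : M₁.IsControl B)
    {b : Time T → SkorokhodSpace T m → Vec d} (hb : ∀ t, Measurable (b t))
    (hpath : ∀ y, IsControlPath M₁.K fun t => b t y)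
    (hBb : ∀ᵐ ω ∂M₁.P, ∀ t, B t ω = b t (M₁.Y ω)) :
    M₂.IsControl fun t ω => b t (M₂.Y ω) where
  adapted t := by
    refine measurable_generatedFiltration_of_map_eq (hY := M₁.measurable_Y) hM.map_Y_eq (hb t)
      fun V hV => ?_
    refine measurableSet_generatedFiltration_of_ae_eq _ _ t
      ((hb t).comp M₁.measurable_Y hV) ?_ (hB.adapted t hV)
    filter_upwards [hBb] with ω hω
    exact congrArg V (hω t).symm
  cadlag ω := (hpath _).cadlag
  decreasing ω := hM.cone_eq ▸ (hpath (M₂.Y ω)).decreasing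
  initial ω := hM.cone_eq ▸ (hpath (M₂.Y ω)).initial
  boundedVariation ω := (hpath _).boundedVariation

end Canonical

/-! ### Measurability on the path space of prices -/

section PathSpace

variable {T : ℝ≥0} {n d : ℕ}

lemma measurable_eval (t : Time T) : Measurable fun s : PathSpace T n => s t :=
  (measurable_pi_apply t).comp (comap_measurable _)

/-- Makes balls measurable for the coordinate σ-algebra; separability then covers all open sets. -/
lemma dist_pathSpace_le_iff {f g : PathSpace T n} {c : ℝ} (hc : 0 ≤ c) :
    dist f g ≤ c ↔ ∀ t ∈ gridSet T, dist (f t) (g t) ≤ c := by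
  rw [ContinuousMap.dist_le hc]
  refine ⟨fun h t _ => h t, fun h t => ?_⟩
  have hlim : Tendsto (fun k => dist (f (nextGrid k t)) (g (nextGrid k t))) atTop
      (𝓝 (dist (f t) (g t))) :=
    (((map_continuous f).tendsto t).comp (tendsto_nextGrid t)).dist
      (((map_continuous g).tendsto t).comp (tendsto_nextGrid t))
  exact le_of_tendsto' hlim fun k => h _ (nextGrid_mem k t)

lemma measurable_dist_pathSpace (g : PathSpace T n) :
    Measurable fun f : PathSpace T n => dist f g := by
  refine measurable_of_Iic fun c => ?_
  by_cases hc : 0 ≤ c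
  · have : (fun f : PathSpace T n => dist f g) ⁻¹' Iic c =
        ⋂ t ∈ gridSet T, {f | dist (f t) (g t) ≤ c} := by
      ext f
      simp only [mem_preimage, mem_Iic, dist_pathSpace_le_iff hc, mem_iInter, mem_ofPred_eq]
    rw [this]
    exact MeasurableSet.biInter countable_gridSet fun t _ =>
      measurableSet_le ((measurable_eval t).dist measurable_const) measurable_const
  · have : (fun f : PathSpace T n => dist f g) ⁻¹' Iic c = ∅ :=
      eq_empty_of_forall_notMem fun f hf => hc (dist_nonneg.trans hf)
    rw [this]
    exact MeasurableSet.empty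

instance : OpensMeasurableSpace (PathSpace T n) := by
  refine ⟨MeasurableSpace.generateFrom_le fun (V : Set (PathSpace T n)) hV => ?_⟩
  choose! ε hε hεV using fun f hf => Metric.isOpen_iff.1 (show IsOpen V from hV) f hf
  obtain ⟨I, hIV, hI, hIU⟩ := TopologicalSpace.isOpen_biUnion_countable V
    (fun f => Metric.ball f (ε f)) fun _ _ => Metric.isOpen_ball
  have : V = ⋃ f ∈ I, Metric.ball f (ε f) := by
    rw [hIU]
    exact Subset.antisymm (fun f hf => mem_biUnion hf (Metric.mem_ball_self (hε f hf)))
      (iUnion₂_subset hεV)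
  rw [this]
  exact MeasurableSet.biUnion hI fun f _ =>
    measurableSet_lt (measurable_dist_pathSpace f) measurable_const

/-- A Carathéodory argument: continuity in the price path and measurability in the position give
joint measurability. Cutting off to zero outside `K` keeps both properties. -/
lemma IsUtility.measurable_uncurry {K : ProperCone ℝ (Vec d)} {U : Vec d → PathSpace T d → ℝ}
    (hU : IsUtility K U) :
    Measurable fun p : PathSpace T d × Vec d =>
      (K : Set (Vec d)).indicator (fun x => U x p.1) p.2 := by
  refine measurable_uncurry_of_continuous_of_measurable
    (u := fun (s : PathSpace T d) (x : Vec d) => (K : Set (Vec d)).indicator (fun x => U x s) x)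
    (fun x => ?_) fun s => ?_
  · by_cases hx : x ∈ (K : Set (Vec d))
    · simp only [Set.indicator_of_mem hx]
      exact hU.continuous x hx
    · simp only [Set.indicator_of_notMem hx]
      exact continuous_const
  · refine measurable_of_restrict_of_restrict_compl K.isClosed.measurableSet ?_ ?_
    · convert! hU.measurable s using 1
      funext x
      exact Set.indicator_of_mem x.2 fun x => U x s
    · convert! (measurable_const : Measurable fun _ : ((K : Set (Vec d))ᶜ : Set (Vec d)) => (0 : ℝ))
        using 1
      funext x
      exact Set.indicator_of_notMem x.2 fun x => U x s

end PathSpace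

/-! ### The portfolio as a functional of the driving process and the prices -/

section Portfolio

variable {T : ℝ≥0} {m d : ℕ}

lemma portfolio_mem_iff {K : ProperCone ℝ (Vec d)} {x : Vec d} {s b : Time T → Vec d} {t : Time T}
    (hs : ∀ i, 0 < s t i) :
    physicalPortfolio x s b t ∈ physicalCone K (s t) ↔ portfolio x s b t ∈ K := by
  constructor
  · rintro ⟨k, hk, hkx⟩
    convert! hk using 1
    ext i
    simp [portfolio, ← hkx, mul_div_cancel₀ _ (hs i).ne']
  · intro h
    refine ⟨_, h, ?_⟩
    ext i
    simp [portfolio, mul_div_cancel_left₀ _ (hs i).ne']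

lemma continuous_one_div_price {s : PathSpace T d} (hs : ∀ t i, 0 < s t i) (i : Fin d) :
    Continuous fun u => 1 / s u i := by
  refine continuous_const.div ?_ fun u => (hs u i).ne'
  fun_prop

lemma tendsto_portfolio_nextGrid (x : Vec d) {s : PathSpace T d} (hs : ∀ t i, 0 < s t i)
    (b : Time T → Vec d) (t : Time T) :
    Tendsto (fun n => portfolio x s b (nextGrid n t)) atTop (𝓝 (portfolio x s b t)) := by
  refine ((PiLp.continuous_toLp 2 _).tendsto _).comp (tendsto_pi_nhds.2 fun i => ?_)
  refine Tendsto.mul ?_ (tendsto_const_nhds.add ?_)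
  · have : Continuous fun u => s u i := by fun_prop
    exact (this.tendsto t).comp (tendsto_nextGrid t)
  · exact tendsto_stieltjesIntegral (continuous_one_div_price hs i) (tendsto_nextGrid t)
      fun n => le_nextGrid n t

lemma IsControlPath.boundedVariationOn_apply {K : ProperCone ℝ (Vec d)} {f : Time T → Vec d}
    (hf : IsControlPath K f) (i : Fin d) : BoundedVariationOn (fun t => f t i) Set.univ :=
  (LipschitzWith.of_dist_le_mul (K := 1) fun x y => by
    simpa using PiLp.dist_apply_le x y i :
      LipschitzWith 1 fun x : Vec d => x i).comp_boundedVariationOn hf.boundedVariation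

lemma IsControlPath.continuousWithinAt_apply {K : ProperCone ℝ (Vec d)} {f : Time T → Vec d}
    (hf : IsControlPath K f) (i : Fin d) (t : Time T) :
    ContinuousWithinAt (fun t => f t i) (Set.Ici t) t :=
  (by fun_prop : Continuous fun x : Vec d => x i).continuousAt.comp_continuousWithinAt
    (hf.cadlag t).1

variable {K : ProperCone ℝ (Vec d)} {b : Time T → SkorokhodSpace T m → Vec d}
  {μ : Measure (SkorokhodSpace T m × PathSpace T d)}

lemma aemeasurable_portfolio (x : Vec d) (hb : ∀ t, Measurable (b t))
    (hpath : ∀ y, IsControlPath K fun t => b t y)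
    (hpos : ∀ᵐ p ∂μ, ∀ (t : Time T) (i : Fin d), 0 < p.2 t i) (t : Time T) :
    AEMeasurable (fun p => portfolio x p.2 (fun u => b u p.1) t) μ := by
  have hprice : ∀ (u : Time T) (i : Fin d),
      Measurable fun p : SkorokhodSpace T m × PathSpace T d => p.2 u i := fun u i =>
    (by fun_prop : Measurable fun x : Vec d => x i).comp ((measurable_eval u).comp measurable_snd)
  have hbm : ∀ (u : Time T) (i : Fin d),
      Measurable fun p : SkorokhodSpace T m × PathSpace T d => b u p.1 i := fun u i =>
    (by fun_prop : Measurable fun x : Vec d => x i).comp ((hb u).comp measurable_fst)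
  refine (WithLp.measurable_toLp 2 _).comp_aemeasurable (aemeasurable_pi_lambda _ fun i => ?_)
  refine (hprice t i).aemeasurable.mul (aemeasurable_const.add ?_)
  refine aemeasurable_of_tendsto_metrizable_ae atTop
    (f := fun n p => riemannSum (fun u => 1 / p.2 u i) (fun u => b u p.1 i) t n) (fun n => ?_) ?_
  · refine Measurable.aemeasurable ?_
    unfold riemannSum
    exact (((hprice _ i).const_div _).mul (hbm _ i)).add (Finset.measurable_sum _ fun j _ =>
      ((hprice _ i).const_div _).mul ((hbm _ i).sub (hbm _ i)))
  · filter_upwards [hpos] with p hp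
    exact tendsto_riemannSum (continuous_one_div_price hp i)
      ((hpath p.1).boundedVariationOn_apply i) ((hpath p.1).continuousWithinAt_apply i) t

/-- The portfolio is right-continuous along the grid and `K` is closed, so the uncountable family of
constraints reduces to grid times wherever prices are positive. -/
lemma nullMeasurableSet_solvent (x : Vec d) (hb : ∀ t, Measurable (b t))
    (hpath : ∀ y, IsControlPath K fun t => b t y)
    (hpos : ∀ᵐ p ∂μ, ∀ (t : Time T) (i : Fin d), 0 < p.2 t i) :
    NullMeasurableSet {p | ∀ t : Time T,
      physicalPortfolio x p.2 (fun u => b u p.1) t ∈ physicalCone K (p.2 t)} μ := by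
  have h : NullMeasurableSet (⋂ t ∈ gridSet T,
      {p | portfolio x p.2 (fun u => b u p.1) t ∈ K}) μ :=
    NullMeasurableSet.biInter countable_gridSet fun t _ =>
      (aemeasurable_portfolio x hb hpath hpos t).nullMeasurable K.isClosed.measurableSet
  refine h.congr ?_
  filter_upwards [hpos] with p hp
  refine propext ?_
  change p ∈ ⋂ t ∈ gridSet T, {p | portfolio x p.2 (fun u => b u p.1) t ∈ K} ↔ ∀ t : Time T, _
  simp only [portfolio_mem_iff (hp _), mem_iInter, mem_ofPred_eq]
  refine ⟨fun h t => ?_, fun h t _ => h t⟩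
  exact K.isClosed.mem_of_tendsto (tendsto_portfolio_nextGrid x hp _ t)
    (Eventually.of_forall fun n => h _ (nextGrid_mem n t))

end Portfolio

/-! ### Invariance of the Bellman function -/

section Bellman

variable {T : ℝ≥0} {m d : ℕ}

lemma ae_map_iff₀ {α β : Type*} [MeasurableSpace α] [MeasurableSpace β] {P : Measure α}
    {f : α → β} (hf : AEMeasurable f P) {p : β → Prop}
    (hp : NullMeasurableSet {y | p y} (P.map f)) :
    (∀ᵐ y ∂P.map f, p y) ↔ ∀ᵐ ω ∂P, p (f ω) := by
  rw [ae_iff, ae_iff, ← Set.compl_ofPred, Measure.map_apply₀ hf hp.compl]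
  rfl

lemma Realization.Equivalent.bellman_le {M₁ : Realization.{u} T m d} {M₂ : Realization.{v} T m d}
    (hM : M₁.Equivalent M₂) {U : Vec d → PathSpace T d → ℝ} (hU : IsUtility M₁.K U) (x : Vec d) :
    M₁.bellman U x ≤ M₂.bellman U x := by
  refine iSup₂_le fun B hB => ?_
  obtain ⟨hBc, hBs⟩ := hB
  obtain ⟨b, hb, hpath, hBb⟩ := hBc.exists_functional
  have hlaw := hM.map_eq
  set μ := M₁.P.map fun ω => (M₁.Y ω, M₁.S ω) with hμ
  have hpos : ∀ᵐ p ∂μ, ∀ (t : Time T) (i : Fin d), 0 < p.2 t i := M₁.regular.price_pos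
  have hnull := nullMeasurableSet_solvent (μ := μ) x hb hpath hpos
  have hsolv₁ : ∀ᵐ ω ∂M₁.P, ∀ t : Time T, physicalPortfolio x (M₁.S ω)
      (fun u => b u (M₁.Y ω)) t ∈ physicalCone M₁.K (M₁.S ω t) := by
    filter_upwards [hBs, hBb] with ω h1 h2
    simpa only [h2] using h1
  have hsolv : ∀ᵐ p ∂μ, ∀ t : Time T,
      physicalPortfolio x p.2 (fun u => b u p.1) t ∈ physicalCone M₁.K (p.2 t) :=
    (ae_map_iff₀ M₁.measurable_YS.aemeasurable hnull).2 hsolv₁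
  -- The same functional, evaluated at the second driving process, is the competitor; its solvency
  -- is read off the common law.
  have hmem : (fun t ω => b t (M₂.Y ω)) ∈ M₂.admissible x := by
    refine ⟨hM.isControl hBc hb hpath hBb, ?_⟩
    rw [hlaw] at hsolv
    rw [← hM.cone_eq]
    exact ae_of_ae_map M₂.measurable_YS.aemeasurable hsolv
  refine le_trans (le_of_eq ?_) (le_iSup₂_of_le _ hmem le_rfl)
  let F : SkorokhodSpace T m × PathSpace T d → ℝ≥0∞ := fun p =>
    ENNReal.ofReal (U (portfolio x p.2 (fun u => b u p.1) (t₁ T)) p.2)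
  have hF : AEMeasurable F μ := by
    have h1 : AEMeasurable (fun p : SkorokhodSpace T m × PathSpace T d =>
        (p.2, portfolio x p.2 (fun u => b u p.1) (t₁ T))) μ :=
      measurable_snd.aemeasurable.prodMk (aemeasurable_portfolio x hb hpath hpos _)
    -- Solvency at the terminal time puts the portfolio in `K`, so the cutoff of `U` is almost
    -- surely invisible.
    refine (hU.measurable_uncurry.comp_aemeasurable h1).ennreal_ofReal.congr ?_
    filter_upwards [hpos, hsolv] with p hp hps
    have := (portfolio_mem_iff (hp _)).1 (hps (t₁ T))
    simp only [F, Function.comp_apply]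
    rw [Set.indicator_of_mem (show _ ∈ (M₁.K : Set (Vec d)) from this)]
  calc ∫⁻ ω, ENNReal.ofReal (U (portfolio x (M₁.S ω) (fun u => B u ω) (t₁ T)) (M₁.S ω)) ∂M₁.P
      = ∫⁻ ω, F (M₁.Y ω, M₁.S ω) ∂M₁.P := by
        refine lintegral_congr_ae ?_
        filter_upwards [hBb] with ω hω
        simp only [F, hω]
    _ = ∫⁻ p, F p ∂μ := (lintegral_map' hF M₁.measurable_YS.aemeasurable).symm
    _ = ∫⁻ ω, F (M₂.Y ω, M₂.S ω) ∂M₂.P := by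
        rw [hlaw] at hF ⊢
        exact lintegral_map' hF M₂.measurable_YS.aemeasurable

end Bellman

end ConeMarket

end

theorem mainTheorem3 {T : NNReal} (hT : 0 < T) {m d : ℕ} (hd : 2 ≤ d)
    (M₁ : ConeMarket.Realization.{u} T m d) (M₂ : ConeMarket.Realization.{v} T m d)
    (hM : M₁.Equivalent M₂)
    (U : ConeMarket.Vec d → ConeMarket.PathSpace T d → ℝ) (hU : ConeMarket.IsUtility M₁.K U)
    (x : ConeMarket.Vec d) (hx : x ∈ M₁.K) :
    M₁.bellman U x = M₂.bellman U x := by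
  have hU₂ : ConeMarket.IsUtility M₂.K U := hM.cone_eq ▸ hU
  exact le_antisymm (hM.bellman_le hU x)
    (ConeMarket.Realization.Equivalent.bellman_le (Eq.symm hM) hU₂ x)
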